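/- Let $\ell^2$ be the complex Hilbert space of square-summable sequences $(x_i)_{i\in\mathbb N}$, and let $\ell^2_{\mathbb R}\subset\ell^2$ be the set of sequences with real entries. For $x\in\ell^2$ let $x^\sharp$ be the functional $x^\sharp(h)=\sum_i x_ih_i$ on $\ell^2$, and let the Varopoulos operator $T_x$ be the bounded operator on the Hilbert space direct sum $\mathbb C\oplus\ell^2\oplus\mathbb C$ given by $T_x(a,h,b)=(x^\sharp(h),\,b\,x,\,0)$; the operators $T_x$, $x\in\ell^2$, commute with each other. For $n\in\mathbb N$ put $$\boldsymbol\delta_n=\{(T_{x_1},\ldots,T_{x_n}) : x_j\in\ell^2_{\mathbb R},\ \|x_j\|\le 1 \text{ for } j=1,\ldots,n\}$$ and $$C_2(\boldsymbol\delta_n)=\sup\{\|p(\boldsymbol T)\| : \boldsymbol T\in\boldsymbol\delta_n,\ p\in\mathbb C[z_1,\ldots,z_n]\text{ homogeneous of degree two},\ \|p\|_{\mathbb D^n,\infty}\le 1\},$$ where $\|p(\boldsymbol T)\|$ is the operator norm and $\|p\|_{\mathbb D^n,\infty}=\sup\{|p(z)| : z\in\mathbb C^n,\ |z_j|<1\text{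 for all }j\}$. Then $C_2(\boldsymbol\delta_3)$ is finite and $$1.2\le C_2(\boldsymbol\delta_3)\le \frac{3\sqrt3}{4}.$$ -/

import Mathlib

noncomputable section

namespace Varopoulos

/-- The complex Hilbert space `ℓ²`. -/
abbrev L2 : Type := lp (fun _ : ℕ => ℂ) 2

/-- The real Hilbert space `ℓ²_ℝ`. -/
abbrev L2R : Type := lp (fun _ : ℕ => ℝ) 2

/-- The inclusion of `ℓ²_ℝ` into `ℓ²`, coordinate by coordinate. -/
def ofRealL2 (x : L2R) : L2 :=
  ⟨fun i => ((x i : ℝ) : ℂ), Memℓp.mono' (g := x) (lp.memℓp x) (fun i => by simp)⟩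

/-- The functional `x^♯` on `ℓ²`, `x^♯(y) = ∑ x_i y_i` (bilinear, see `sharp_apply`). -/
def sharp (x : L2) : L2 →L[ℂ] ℂ := innerSL ℂ (star x)

theorem sharp_apply (x y : L2) : sharp x y = ∑' i, x i * y i := by
  simp [sharp, lp.inner_eq_tsum, mul_comm]

/-- The Hilbert space direct sum `ℂ ⊕ ℓ² ⊕ ℂ`. -/
abbrev V : Type := WithLp 2 (ℂ × WithLp 2 (L2 × ℂ))

/-- The element `(a, h, b)` of `ℂ ⊕ ℓ² ⊕ ℂ`. -/
def vec (a : ℂ) (h : L2) (b : ℂ) : V := WithLp.toLp 2 (a, WithLp.toLp 2 (h, b))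

/-- The Varopoulos operator `T_{x,y}` on `ℂ ⊕ ℓ² ⊕ ℂ`, with matrix
`(0, x^♯, 0; 0, 0, y; 0, 0, 0)`: it sends `(a, h, b)` to `(x^♯(h), b y, 0)`. -/
def op (x y : L2) : V →L[ℂ] V where
  toFun v := vec (sharp x v.snd.fst) (v.snd.snd • y) 0
  map_add' v w := by
    simp [vec, add_smul, ← WithLp.toLp_add]
  map_smul' c v := by
    simp [vec, mul_smul, ← WithLp.toLp_smul]
  cont := by
    unfold vec
    fun_prop

theorem op_apply (x y h : L2) (a b : ℂ) :
    op x y (vec a h b) = vec (sharp x h) (b • y) 0 := rfl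

/-- `T_x = T_{x,x}`. -/
def opSelf (x : L2) : V →L[ℂ] V := op x x

theorem sharp_comm (x y : L2) : sharp x y = sharp y x := by
  simp [sharp_apply, mul_comm]

theorem opSelf_commute (x y : L2) : Commute (opSelf x) (opSelf y) := by
  ext v
  simp [opSelf, op, vec, sharp_comm x y]

/-- The value `p(T_1, …, T_n)` of a polynomial at a (commuting) tuple in a complex algebra:
the monomial `c z_1^{m_1} ⋯ z_n^{m_n}` is sent to `c T_1^{m_1} ⋯ T_n^{m_n}`. -/
def polyEval {n : ℕ} {R : Type*} [Ring R] [Algebra ℂ R]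
    (p : MvPolynomial (Fin n) ℂ) (T : Fin n → R) : R :=
  ∑ m ∈ p.support, p.coeff m • (List.ofFn fun j => T j ^ m j).prod

/-- The supremum norm `‖p‖_{𝔻^n,∞}` over the open unit polydisc (the supremum is of a bounded
set, see `bddAbove_polydisc`). -/
def polydiscNorm {n : ℕ} (p : MvPolynomial (Fin n) ℂ) : ℝ :=
  ⨆ z : {z : Fin n → ℂ // ∀ j, ‖z j‖ < 1}, ‖MvPolynomial.eval z.1 p‖

theorem bddAbove_polydisc {n : ℕ} (p : MvPolynomial (Fin n) ℂ) :
    BddAbove (Set.range fun z : {z : Fin n → ℂ // ∀ j, ‖z j‖ < 1} =>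
      ‖MvPolynomial.eval z.1 p‖) := by
  have hc : Continuous fun z : Fin n → ℂ => ‖MvPolynomial.eval z p‖ :=
    (MvPolynomial.continuous_eval p).norm
  refine ((isCompact_closedBall (0 : Fin n → ℂ) 1).image hc).bddAbove.mono ?_
  rintro _ ⟨z, rfl⟩
  exact ⟨z.1, by simpa [pi_norm_le_iff_of_nonneg] using fun j => (z.2 j).le, rfl⟩

/-- The set `δ_n` of tuples `(T_{x_1}, …, T_{x_n})`, where `x_1, …, x_n` are in the closed unit
ball of `ℓ²_ℝ`. -/
def delta (n : ℕ) : Set (Fin n → V →L[ℂ] V) :=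
  {T | ∃ x : Fin n → L2R, (∀ j, ‖x j‖ ≤ 1) ∧ T = fun j => opSelf (ofRealL2 (x j))}

/-- The values `‖p(T)‖`, for `T` in `δ_n` and `p` a homogeneous polynomial of degree two in `n`
variables with `‖p‖_{𝔻^n,∞} ≤ 1`. -/
def valuesTwo (n : ℕ) : Set ℝ :=
  {r | ∃ T ∈ delta n, ∃ p : MvPolynomial (Fin n) ℂ,
    p.IsHomogeneous 2 ∧ polydiscNorm p ≤ 1 ∧ r = ‖polyEval p T‖}

/-- The constant `C_2(δ_n)`. -/
def CTwo (n : ℕ) : ℝ := sSup (valuesTwo n)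

end Varopoulos

end

/-! Since `T_x T_y = ⟨x, y⟩ E` with `E` a fixed operator of norm one, `‖p(T)‖` is the modulus of the
coefficients of `p` paired with the Gram matrix of the vectors. Upper bound: a Gram matrix of three
real vectors is a convex combination of two planar ones with the same diagonal
(`exists_planar_gram`), so the entries may be taken to be `Re (w_i w̄_j)` with `|w_j| ≤ 1`. There
are holomorphic curves `u_j` in the closed disc with `u_j(0) = r w̄_j` and `u_j'(0) = (1 - r²) w_j`,
so `(u_i u_j)'(0) = 2r(1 - r²) Re (w_i w̄_j)`. Cauchy's estimate for `p ∘ u` bounds the pairing by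
`1 / (2r(1 - r²))`, which is least at `r = 1/√3`, with value `3√3/4`. Lower bound: the
Varopoulos–Kaijser form has norm at most `5` on the polydisc, and three unit vectors at angles of
120° give it the value `6`. -/

noncomputable section

namespace Varopoulos

open ComplexConjugate

/-! ### Ternary quadratic forms and their coefficients -/

/-- The pairing `∑ c_{jk} G_{jk}` of the coefficients of a ternary quadratic form, in the order
`11, 22, 33, 12, 13, 23`, with a `3 × 3` array. -/
def pairing (c : Fin 6 → ℂ) {M : Type*} [AddCommMonoid M] [Module ℂ M]
    (G : Fin 3 → Fin 3 → M) : M :=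
  c 0 • G 0 0 + c 1 • G 1 1 + c 2 • G 2 2 + c 3 • G 0 1 + c 4 • G 0 2 + c 5 • G 1 2

/-- The exponents of the monomials of degree two in three variables. -/
def quadExp : Fin 6 → (Fin 3 →₀ ℕ) :=
  ![Finsupp.single 0 2, Finsupp.single 1 2, Finsupp.single 2 2,
    Finsupp.single 0 1 + Finsupp.single 1 1, Finsupp.single 0 1 + Finsupp.single 2 1,
    Finsupp.single 1 1 + Finsupp.single 2 1]

theorem quadExp_injective : Function.Injective quadExp := by
  intro i j h
  have h0 := DFunLike.congr_fun h 0
  have h1 := DFunLike.congr_fun h 1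
  have h2 := DFunLike.congr_fun h 2
  fin_cases i <;> fin_cases j <;> simp [quadExp] at h0 h1 h2 ⊢

theorem exists_quadExp_eq {m : Fin 3 →₀ ℕ} (h : m 0 + m 1 + m 2 = 2) : ∃ i, quadExp i = m := by
  have key : ∀ i, quadExp i 0 = m 0 → quadExp i 1 = m 1 → quadExp i 2 = m 2 →
      ∃ i, quadExp i = m := by
    intro i h0 h1 h2
    refine ⟨i, Finsupp.ext fun k => ?_⟩
    fin_cases k
    exacts [h0, h1, h2]
  have b0 : m 0 ≤ 2 := by omega
  have b1 : m 1 ≤ 2 := by omega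
  have h2 : m 2 = 2 - m 0 - m 1 := by omega
  generalize m 0 = a at *
  generalize m 1 = b at *
  generalize m 2 = d at *
  subst h2
  interval_cases a <;> interval_cases b <;> simp at h
  · exact key 2 (by simp [quadExp]) (by simp [quadExp]) (by simp [quadExp])
  · exact key 5 (by simp [quadExp]) (by simp [quadExp]) (by simp [quadExp])
  · exact key 1 (by simp [quadExp]) (by simp [quadExp]) (by simp [quadExp])
  · exact key 4 (by simp [quadExp]) (by simp [quadExp]) (by simp [quadExp])
  · exact key 3 (by simp [quadExp]) (by simp [quadExp]) (by simp [quadExp])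
  · exact key 0 (by simp [quadExp]) (by simp [quadExp]) (by simp [quadExp])

/-- The coefficients of the quadratic part of a polynomial in three variables. -/
def quadCoeff (p : MvPolynomial (Fin 3) ℂ) (i : Fin 6) : ℂ := p.coeff (quadExp i)

theorem polyEval_eq_pairing {R : Type*} [Ring R] [Algebra ℂ R] {p : MvPolynomial (Fin 3) ℂ}
    (hp : p.IsHomogeneous 2) (T : Fin 3 → R) :
    polyEval p T = pairing (quadCoeff p) (fun i j => T i * T j) := by
  have hsub : p.support ⊆ Finset.univ.image quadExp := by
    intro m hm
    have hd := hp (MvPolynomial.mem_support_iff.mp hm)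
    rw [Finsupp.weight_apply, Finsupp.sum_fintype _ _ (by simp)] at hd
    simp [Fin.sum_univ_three] at hd
    simpa using exists_quadExp_eq hd
  rw [polyEval, Finset.sum_subset hsub (fun m _ hm => by
    rw [MvPolynomial.notMem_support_iff.mp hm, zero_smul]),
    Finset.sum_image (fun _ _ _ _ h => quadExp_injective h)]
  simp [Fin.sum_univ_six, quadExp, quadCoeff, pairing, List.ofFn_succ, pow_two]

theorem polyEval_eq_eval {n : ℕ} (p : MvPolynomial (Fin n) ℂ) (z : Fin n → ℂ) :
    polyEval p z = MvPolynomial.eval z p := by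
  simp [polyEval, MvPolynomial.eval_eq', List.prod_ofFn]

theorem eval_eq_pairing {p : MvPolynomial (Fin 3) ℂ} (hp : p.IsHomogeneous 2) (z : Fin 3 → ℂ) :
    MvPolynomial.eval z p = pairing (quadCoeff p) (fun i j => z i * z j) := by
  rw [← polyEval_eq_eval, polyEval_eq_pairing hp]

theorem pairing_smul (c : Fin 6 → ℂ) {M : Type*} [AddCommMonoid M] [Module ℂ M]
    (G : Fin 3 → Fin 3 → ℂ) (E : M) :
    pairing c (fun i j => G i j • E) = pairing c G • E := by
  simp [pairing, add_smul, mul_smul]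

/-- The supremum is over the open polydisc; boundary points are radial limits `t z` as `t → 1⁻`. -/
theorem norm_eval_le_polydiscNorm {n : ℕ} (p : MvPolynomial (Fin n) ℂ) {z : Fin n → ℂ}
    (hz : ∀ j, ‖z j‖ ≤ 1) : ‖MvPolynomial.eval z p‖ ≤ polydiscNorm p := by
  have hc : Continuous fun t : ℝ => ‖MvPolynomial.eval (fun j => (t : ℂ) * z j) p‖ :=
    ((MvPolynomial.continuous_eval p).comp (by fun_prop)).norm
  have h1 := (hc.tendsto 1).mono_left (nhdsWithin_le_nhds (s := Set.Iio 1))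
  refine le_of_tendsto (by simpa using h1) ?_
  filter_upwards [Ioo_mem_nhdsLT one_pos] with t ht
  refine le_ciSup (bddAbove_polydisc p) ⟨fun j => (t : ℂ) * z j, fun j => ?_⟩
  rw [norm_mul, Complex.norm_real, Real.norm_of_nonneg ht.1.le]
  nlinarith [hz j, ht.1, ht.2, norm_nonneg (z j)]

/-! ### Reduction to Gram matrices -/

/-- The rank-one operator `(a, h, b) ↦ (b, 0, 0)`. -/
def corner : V →L[ℂ] V where
  toFun v := vec v.snd.snd 0 0
  map_add' v w := by simp [vec, ← WithLp.toLp_add]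
  map_smul' c v := by simp [vec, ← WithLp.toLp_smul]
  cont := by
    unfold vec
    fun_prop

theorem norm_vec_left (a : ℂ) : ‖vec a 0 0‖ = ‖a‖ := by
  simp [vec, WithLp.prod_norm_eq_of_L2]

theorem norm_corner : ‖corner‖ = 1 := by
  refine ContinuousLinearMap.opNorm_eq_of_bounds zero_le_one (fun v => ?_) (fun N _ h => ?_)
  · rw [one_mul]
    exact (norm_vec_left _).trans_le ((WithLp.norm_snd_le _ v.snd).trans (WithLp.norm_snd_le _ v))
  · have := h (vec 0 0 1)
    have h1 : corner (vec 0 0 1) = vec 1 0 0 := rfl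
    rw [h1, norm_vec_left] at this
    simpa [vec, WithLp.prod_norm_eq_of_L2] using this

theorem opSelf_mul_opSelf (x y : L2) : opSelf x * opSelf y = sharp x y • corner := by
  ext v
  simp [opSelf, op, corner, vec, ← WithLp.toLp_smul, mul_comm]

theorem sharp_ofRealL2 (x y : L2R) : sharp (ofRealL2 x) (ofRealL2 y) = ((inner ℝ x y : ℝ) : ℂ) := by
  rw [sharp_apply, lp.inner_eq_tsum, Complex.ofReal_tsum]
  simp [ofRealL2, mul_comm]

theorem norm_polyEval_opSelf {p : MvPolynomial (Fin 3) ℂ} (hp : p.IsHomogeneous 2)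
    (x : Fin 3 → L2R) :
    ‖polyEval p (fun j => opSelf (ofRealL2 (x j)))‖ =
      ‖pairing (quadCoeff p) (fun i j => ((inner ℝ (x i) (x j) : ℝ) : ℂ))‖ := by
  rw [polyEval_eq_pairing hp]
  simp only [opSelf_mul_opSelf, sharp_ofRealL2]
  rw [pairing_smul, norm_smul, norm_corner, mul_one]

/-! ### Planar Gram matrices: Möbius curves and Cauchy's estimate -/

/-- The difference of the squared norms is `(1 - r²)(1 - |σ|²)`. This keeps `mobiusCurve` in the
closed disc. -/
theorem norm_add_le_norm_one_add {σ : ℂ} (hσ : ‖σ‖ ≤ 1) {r : ℝ} (h0 : 0 ≤ r) (h1 : r ≤ 1) :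
    ‖σ + r‖ ≤ ‖1 + r * σ‖ := by
  have hs : σ.re ^ 2 + σ.im ^ 2 ≤ 1 := by
    have := pow_le_one₀ (n := 2) (norm_nonneg _) hσ
    rw [Complex.sq_norm, Complex.normSq_apply] at this
    linarith
  refine le_of_sq_le_sq ?_ (norm_nonneg _)
  rw [Complex.sq_norm, Complex.sq_norm, Complex.normSq_apply, Complex.normSq_apply]
  simp
  nlinarith [mul_nonneg (sub_nonneg.2 hs) (sub_nonneg.2 (pow_le_one₀ (n := 2) h0 h1))]

theorem exists_unimodular (w : ℂ) : ∃ v : ℂ, ‖v‖ = 1 ∧ w = ‖w‖ * v :=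
  ⟨Complex.exp (w.arg * Complex.I), Complex.norm_exp_ofReal_mul_I _,
    (Complex.norm_mul_exp_arg_mul_I w).symm⟩

/-- The curve in the closed unit disc used in the Cauchy estimate: `‖w‖ v̄` times a Möbius map of
`v² s`, where `w = ‖w‖ v`. -/
def mobiusCurve (r : ℝ) (w v s : ℂ) : ℂ := (w * s + r * conj w) / (1 + r * v ^ 2 * s)

variable {r : ℝ} {w v s : ℂ}

theorem one_add_ne_zero (h0 : 0 ≤ r) (h1 : r < 1) (hv : ‖v‖ = 1) (hs : ‖s‖ ≤ 1) :
    1 + r * v ^ 2 * s ≠ 0 := by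
  intro h
  have h2 : (r * v ^ 2 * s : ℂ) = -1 := by linear_combination h
  have h3 := congrArg norm h2
  simp [hv, abs_of_nonneg h0] at h3
  nlinarith [norm_nonneg s]

theorem norm_mobiusCurve_le (h0 : 0 ≤ r) (h1 : r < 1) (hv : ‖v‖ = 1) (hw : ‖w‖ ≤ 1)
    (hwv : w = ‖w‖ * v) (hs : ‖s‖ ≤ 1) : ‖mobiusCurve r w v s‖ ≤ 1 := by
  have hvv : conj v * v = 1 := by rw [mul_comm, Complex.mul_conj']; simp [hv]
  have hnum : w * s + r * conj w = (‖w‖ * conj v) * (v ^ 2 * s + r) := by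
    have : conj w = ‖w‖ * conj v := by
      conv_lhs => rw [hwv]
      simp
    rw [this]
    conv_lhs => rw [hwv]
    simp only [norm_mul, Complex.norm_real, norm_norm, hv, mul_one]
    linear_combination (-(‖w‖ : ℂ) * v * s) * hvv
  have hσ : ‖v ^ 2 * s‖ ≤ 1 := by simpa [hv] using hs
  have := norm_add_le_norm_one_add hσ h0 h1.le
  rw [mobiusCurve, norm_div, div_le_one (norm_pos_iff.2 (one_add_ne_zero h0 h1 hv hs)), hnum,
    norm_mul, norm_mul, RCLike.norm_conj, hv]
  simp only [Complex.norm_real, norm_norm, mul_one]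
  rw [mul_assoc (r : ℂ)]
  nlinarith [norm_nonneg (v ^ 2 * s + (r : ℂ))]

theorem differentiableAt_mobiusCurve (h0 : 0 ≤ r) (h1 : r < 1) (hv : ‖v‖ = 1) (hs : ‖s‖ ≤ 1) :
    DifferentiableAt ℂ (mobiusCurve r w v) s := by
  unfold mobiusCurve
  exact DifferentiableAt.fun_div (by fun_prop) (by fun_prop) (one_add_ne_zero h0 h1 hv hs)

/-- The denominator is chosen with `v²` because `w̄ v² = w`: its contribution to the derivative is
then `-r² w`. -/
theorem hasDerivAt_mobiusCurve (hv : ‖v‖ = 1) (hwv : w = ‖w‖ * v) :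
    HasDerivAt (mobiusCurve r w v) ((1 - r ^ 2) * w) 0 := by
  have hvv : conj v * v = 1 := by rw [mul_comm, Complex.mul_conj']; simp [hv]
  have hcw : conj w * v ^ 2 = w := by
    have : conj w = ‖w‖ * conj v := by
      conv_lhs => rw [hwv]
      simp
    rw [this]
    conv_rhs => rw [hwv]
    linear_combination ((‖w‖ : ℂ) * v) * hvv
  have hn : HasDerivAt (fun s : ℂ => w * s + r * conj w) w 0 := by
    simpa using ((hasDerivAt_id (0 : ℂ)).const_mul w).add_const (r * conj w)
  have hd : HasDerivAt (fun s : ℂ => 1 + r * v ^ 2 * s) (r * v ^ 2) 0 := by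
    simpa using ((hasDerivAt_id (0 : ℂ)).const_mul (r * v ^ 2)).const_add 1
  have := hn.fun_div hd (by simp)
  refine this.congr_deriv ?_
  simp
  linear_combination (-(r : ℂ) ^ 2) * hcw

theorem mobiusCurve_zero : mobiusCurve r w v 0 = r * conj w := by simp [mobiusCurve]

theorem norm_pairing_planar_le_aux {c : Fin 6 → ℂ} {M : ℝ}
    (hc : ∀ z : Fin 3 → ℂ, (∀ j, ‖z j‖ ≤ 1) → ‖pairing c (fun i j => z i * z j)‖ ≤ M)
    (h0 : 0 ≤ r) (h1 : r < 1) {w : Fin 3 → ℂ} (hw : ∀ j, ‖w j‖ ≤ 1) :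
    2 * r * (1 - r ^ 2) * ‖pairing c (fun i j => (((w i * conj (w j)).re : ℝ) : ℂ))‖ ≤ M := by
  choose v hv hwv using fun j => exists_unimodular (w j)
  set u : Fin 3 → ℂ → ℂ := fun j => mobiusCurve r (w j) (v j) with hu
  set F : ℂ → ℂ := fun s => pairing c (fun i j => u i s * u j s) with hF
  have hud : ∀ j, HasDerivAt (u j) ((1 - r ^ 2) * w j) 0 := fun j =>
    hasDerivAt_mobiusCurve (hv j) (hwv j)
  have hprod : ∀ i j, HasDerivAt (fun s => u i s * u j s)
      (((2 * r * (1 - r ^ 2) : ℝ) : ℂ) * (((w i * conj (w j)).re : ℝ) : ℂ)) 0 := by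
    intro i j
    refine ((hud i).fun_mul (hud j)).congr_deriv ?_
    simp only [hu, mobiusCurve_zero]
    apply Complex.ext <;> simp [← Complex.ofReal_pow] <;> ring
  have hFd : HasDerivAt F (((2 * r * (1 - r ^ 2) : ℝ) : ℂ) *
      pairing c (fun i j => (((w i * conj (w j)).re : ℝ) : ℂ))) 0 := by
    have := ((((((hprod 0 0).const_mul (c 0)).fun_add ((hprod 1 1).const_mul (c 1))).fun_add
      ((hprod 2 2).const_mul (c 2))).fun_add ((hprod 0 1).const_mul (c 3))).fun_add
      ((hprod 0 2).const_mul (c 4))).fun_add ((hprod 1 2).const_mul (c 5))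
    refine this.congr_deriv ?_
    simp only [pairing, smul_eq_mul]
    ring
  have hdiff : DiffContOnCl ℂ F (Metric.ball 0 1) := by
    refine DifferentiableOn.diffContOnCl fun s hs => DifferentiableAt.differentiableWithinAt ?_
    rw [closure_ball _ one_ne_zero, mem_closedBall_zero_iff] at hs
    have hj : ∀ j, DifferentiableAt ℂ (u j) s := fun j =>
      differentiableAt_mobiusCurve h0 h1 (hv j) hs
    have h0 := hj 0
    have h1 := hj 1
    have h2 := hj 2
    simp only [hF, pairing, smul_eq_mul]
    fun_prop
  have := Complex.norm_deriv_le_of_forall_mem_sphere_norm_le one_pos hdiff (C := M) (fun s hs =>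
    hc _ fun j => norm_mobiusCurve_le h0 h1 (hv j) (hw j) (hwv j)
      (mem_sphere_zero_iff_norm.1 hs).le)
  rw [hFd.deriv, div_one, norm_mul, Complex.norm_real, Real.norm_of_nonneg (by
    have : r ^ 2 ≤ 1 := pow_le_one₀ h0 h1.le
    exact mul_nonneg (by positivity) (by linarith))] at this
  exact this

theorem norm_pairing_planar_le {c : Fin 6 → ℂ} {M : ℝ}
    (hc : ∀ z : Fin 3 → ℂ, (∀ j, ‖z j‖ ≤ 1) → ‖pairing c (fun i j => z i * z j)‖ ≤ M)
    {w : Fin 3 → ℂ} (hw : ∀ j, ‖w j‖ ≤ 1) :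
    ‖pairing c (fun i j => (((w i * conj (w j)).re : ℝ) : ℂ))‖ ≤ 3 * Real.sqrt 3 / 4 * M := by
  have hs : Real.sqrt 3 ^ 2 = 3 := Real.sq_sqrt (by norm_num)
  have hs0 : 0 ≤ Real.sqrt 3 := Real.sqrt_nonneg 3
  -- `1/√3` maximises `2r(1 - r²)` on `[0, 1]`.
  have := norm_pairing_planar_le_aux hc (r := Real.sqrt 3 / 3) (by positivity)
    (by nlinarith) hw
  have hr : 2 * (Real.sqrt 3 / 3) * (1 - (Real.sqrt 3 / 3) ^ 2) = 4 / 9 * Real.sqrt 3 := by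
    rw [div_pow, hs]; ring
  rw [hr] at this
  have h2 := mul_le_mul_of_nonneg_left this (by positivity : 0 ≤ 3 * Real.sqrt 3 / 4)
  refine le_trans (le_of_eq ?_) h2
  linear_combination (-(1 : ℝ) / 3 *
    ‖pairing c (fun i j => (((w i * conj (w j)).re : ℝ) : ℂ))‖) * hs

/-! ### From three vectors to planar configurations -/

/-- Two planar configurations whose Gram matrices have the given three vectors' Gram matrix as a
convex combination. -/
theorem exists_planar_gram {H : Type*} [NormedAddCommGroup H] [InnerProductSpace ℝ H]
    (x : Fin 3 → H) : ∃ (w w' : Fin 3 → ℂ) (t : ℝ), 0 ≤ t ∧ t ≤ 1 ∧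
      (∀ j, ‖w j‖ = ‖x j‖) ∧ (∀ j, ‖w' j‖ = ‖x j‖) ∧ ∀ i j,  i ≤ j → inner ℝ (x i) (x j) =
        t * (w i * conj (w j)).re + (1 - t) * (w' i * conj (w' j)).re := by
  -- If `x 2 = 0`, then `e = 0`, and the decomposition along `e` below still holds.
  set e : H := ‖x 2‖⁻¹ • x 2 with he
  have hee : inner ℝ e e = 1 ∨ x 2 = 0 := by
    by_cases h : x 2 = 0
    · exact Or.inr h
    · left
      rw [real_inner_self_eq_norm_sq, he, norm_smul, norm_inv, norm_norm,
        inv_mul_cancel₀ (norm_ne_zero_iff.2 h), one_pow]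
  have hxe : x 2 = ‖x 2‖ • e := by
    rcases eq_or_ne (x 2) 0 with h | h
    · simp [h]
    · rw [he, smul_smul, mul_inv_cancel₀ (norm_ne_zero_iff.2 h), one_smul]
  set a : H → ℝ := fun z => inner ℝ z e with ha
  set y : H → H := fun z => z - a z • e with hy
  have hin : ∀ z z', inner ℝ z z' = a z * a z' + inner ℝ (y z) (y z') := by
    intro z z'
    rcases hee with h | h
    · simp only [hy, ha, inner_sub_left, inner_sub_right, inner_smul_left, inner_smul_right, h,
        real_inner_comm e z']
      simp
    · have : e = 0 := by simp [he, h]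
      simp [hy, ha, this]
  have hz2 : ∀ z, inner ℝ z (x 2) = a z * ‖x 2‖ := by
    intro z
    conv_lhs => rw [hxe]
    rw [inner_smul_right, mul_comm]
  have hsq : ∀ z, a z * a z + ‖y z‖ * ‖y z‖ = ‖z‖ ^ 2 := by
    intro z
    rw [← real_inner_self_eq_norm_sq, hin, real_inner_self_eq_norm_mul_norm]
  have hnorm : ∀ z (b : ℝ), b * b = ‖y z‖ * ‖y z‖ → ‖(⟨a z, b⟩ : ℂ)‖ = ‖z‖ := by
    intro z b hb
    rw [← sq_eq_sq₀ (norm_nonneg _) (norm_nonneg _), Complex.sq_norm, Complex.normSq_mk, hb, hsq]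
  -- By Cauchy–Schwarz the inner product of the components orthogonal to `e` lies between
  -- `∓‖y₀‖‖y₁‖`, the values for antiparallel and parallel components; `t` is the weight of the
  -- parallel case.
  obtain ⟨t, ht0, ht1, ht⟩ : ∃ t : ℝ, 0 ≤ t ∧ t ≤ 1 ∧
      inner ℝ (y (x 0)) (y (x 1)) = (2 * t - 1) * (‖y (x 0)‖ * ‖y (x 1)‖) := by
    have hcs := abs_le.1 (abs_real_inner_le_norm (y (x 0)) (y (x 1)))
    rcases (mul_nonneg (norm_nonneg (y (x 0))) (norm_nonneg (y (x 1)))).eq_or_lt with h | h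
    · refine ⟨0, le_rfl, zero_le_one, ?_⟩
      rw [← h] at hcs ⊢
      linarith
    · set P := ‖y (x 0)‖ * ‖y (x 1)‖
      refine ⟨(inner ℝ (y (x 0)) (y (x 1)) / P + 1) / 2, ?_, ?_, ?_⟩
      · have : -1 ≤ inner ℝ (y (x 0)) (y (x 1)) / P := by rw [le_div_iff₀ h]; linarith
        linarith
      · have : inner ℝ (y (x 0)) (y (x 1)) / P ≤ 1 := by rw [div_le_iff₀ h]; linarith
        linarith
      · field_simp
        ring
  have h00 := hsq (x 0)
  have h11 := hsq (x 1)
  -- The real axis plays the role of `e`; reflecting the second vector in it changes only the `01`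
  -- entry among those with `i ≤ j` and keeps the norms.
  refine ⟨![⟨a (x 0), ‖y (x 0)‖⟩, ⟨a (x 1), ‖y (x 1)‖⟩, ‖x 2‖],
    ![⟨a (x 0), ‖y (x 0)‖⟩, ⟨a (x 1), -‖y (x 1)‖⟩, ‖x 2‖], t, ht0, ht1, ?_, ?_, ?_⟩
  · intro j
    fin_cases j
    · exact hnorm _ _ rfl
    · exact hnorm _ _ rfl
    · simp
  · intro j
    fin_cases j
    · exact hnorm _ _ rfl
    · exact hnorm _ _ (by ring)
    · simp
  · have h01 := hin (x 0) (x 1)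
    rw [ht] at h01
    intro i j hij
    fin_cases i <;> fin_cases j <;> simp at hij
    · simp; linarith
    · simp; linarith
    · simp [hz2]; ring
    · simp; linarith
    · simp [hz2]; ring
    · simp; ring

theorem norm_pairing_gram_le {c : Fin 6 → ℂ} {M : ℝ}
    (hc : ∀ z : Fin 3 → ℂ, (∀ j, ‖z j‖ ≤ 1) → ‖pairing c (fun i j => z i * z j)‖ ≤ M)
    {H : Type*} [NormedAddCommGroup H] [InnerProductSpace ℝ H] {x : Fin 3 → H}
    (hx : ∀ j, ‖x j‖ ≤ 1) :
    ‖pairing c (fun i j => ((inner ℝ (x i) (x j) : ℝ) : ℂ))‖ ≤ 3 * Real.sqrt 3 / 4 * M := by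
  obtain ⟨w, w', t, ht0, ht1, hw, hw', h⟩ := exists_planar_gram x
  have h1 := norm_pairing_planar_le hc (w := w) fun j => (hw j).trans_le (hx j)
  have h2 := norm_pairing_planar_le hc (w := w') fun j => (hw' j).trans_le (hx j)
  set A := pairing c (fun i j => (((w i * conj (w j)).re : ℝ) : ℂ)) with hA
  set B := pairing c (fun i j => (((w' i * conj (w' j)).re : ℝ) : ℂ)) with hB
  have heq : pairing c (fun i j => ((inner ℝ (x i) (x j) : ℝ) : ℂ)) =
      (t : ℂ) * A + ((1 - t : ℝ) : ℂ) * B := by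
    simp only [hA, hB, pairing, h 0 0 le_rfl, h 1 1 le_rfl, h 2 2 le_rfl, h 0 1 (by decide),
      h 0 2 (by decide), h 1 2 (by decide), smul_eq_mul, Complex.ofReal_add, Complex.ofReal_mul]
    ring
  rw [heq]
  refine (norm_add_le _ _).trans ?_
  rw [norm_mul, norm_mul, Complex.norm_real, Complex.norm_real, Real.norm_of_nonneg ht0,
    Real.norm_of_nonneg (sub_nonneg.2 ht1)]
  nlinarith [mul_le_mul_of_nonneg_left h1 ht0, mul_le_mul_of_nonneg_left h2 (sub_nonneg.2 ht1)]

theorem le_of_mem_valuesTwo {s : ℝ} (hs : s ∈ valuesTwo 3) : s ≤ 3 * Real.sqrt 3 / 4 := by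
  obtain ⟨T, ⟨x, hx, rfl⟩, p, hp, hp1, rfl⟩ := hs
  rw [norm_polyEval_opSelf hp]
  have := norm_pairing_gram_le (c := quadCoeff p) (M := 1) (fun z hz => by
    rw [← eval_eq_pairing hp]
    exact (norm_eval_le_polydiscNorm p hz).trans hp1) hx
  simpa using this

/-! ### The Varopoulos–Kaijser form on the polydisc -/

theorem norm_le_of_forall_norm_eq_one {f : ℂ → ℂ} (hf : Differentiable ℂ f) {M : ℝ}
    (h : ∀ z, ‖z‖ = 1 → ‖f z‖ ≤ M) {z : ℂ} (hz : ‖z‖ ≤ 1) : ‖f z‖ ≤ M := by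
  refine Complex.norm_le_of_forall_mem_frontier_norm_le (U := Metric.ball 0 1)
    Metric.isBounded_ball hf.diffContOnCl (fun w hw => h w ?_) ?_
  · simpa [frontier_ball] using hw
  · simpa [closure_ball] using hz

/-- The Varopoulos–Kaijser quadratic form. -/
def kvForm (a b c : ℂ) : ℂ := a ^ 2 + b ^ 2 + c ^ 2 - 2 * a * b - 2 * a * c - 2 * b * c

/-- With `c = cos v` and `t = cos u`, eight times this expression is `25 - |kvForm|²` on the torus.
-/
theorem trig_quartic_nonneg {c t : ℝ} (hc : c ^ 2 ≤ 1) (ht : t ^ 2 ≤ 1) :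
    0 ≤ 2 * (1 - c ^ 2) * (t - c) ^ 2 + c * (t + c) := by
  rcases le_or_gt 0 (c * (t + c)) with h | h
  · have : 0 ≤ (1 - c ^ 2) * (t - c) ^ 2 := mul_nonneg (by linarith) (sq_nonneg _)
    linarith
  -- Here `c` and `t` have opposite signs and `|t| > |c|`, so `s` stands for `|t|`. Multiplying by
  -- `s²` and using `s² - c² ≤ s²(1 - c²)` lets the factor `s - c` be taken out.
  · have key : ∀ c s : ℝ, 0 < c → c < s → s ^ 2 ≤ 1 → c ^ 2 ≤ 1 →
        0 ≤ 2 * (1 - c ^ 2) * (s + c) ^ 2 - c * (s - c) := by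
      intro c s hc0 hcs hs hc1
      have hs0 : 0 < s := hc0.trans hcs
      refine nonneg_of_mul_nonneg_right (a := s ^ 2) ?_ (by positivity)
      have h1 : s ^ 2 - c ^ 2 ≤ s ^ 2 * (1 - c ^ 2) := by nlinarith [sq_nonneg c]
      have h2 := mul_le_mul_of_nonneg_right h1 (sq_nonneg (s + c))
      have h3 : 0 ≤ (s - c) * (2 * (s + c) ^ 3 - s ^ 2 * c) := by
        refine mul_nonneg (by linarith) ?_
        have : 2 * (s + c) ^ 3 - s ^ 2 * c
          = 2 * s ^ 3 + 5 * s ^ 2 * c + 6 * s * c ^ 2 + 2 * c ^ 3 := by ring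
        rw [this]
        positivity
      nlinarith
    rcases lt_trichotomy c 0 with h0 | h0 | h0
    · have := key (-c) t (by linarith) (by nlinarith) ht (by simpa using hc)
      nlinarith
    · simp [h0] at h
    · have := key c (-t) h0 (by nlinarith) (by simpa using ht) hc
      nlinarith

theorem norm_kvForm_exp_le (x y z : ℝ) :
    ‖kvForm (Complex.exp (x * Complex.I)) (Complex.exp (y * Complex.I))
      (Complex.exp (z * Complex.I))‖ ≤ 5 := by
  set u : ℝ := (x + y) / 2 - z with hu
  set v : ℝ := (x - y) / 2 with hv
  -- `R` is the mean phase of the first two points, so that the three points are `R e^{iv}`, `R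
  -- e^{-iv}` and `R e^{-iu}`.
  set R := Complex.exp ((((x + y) / 2 : ℝ) : ℂ) * Complex.I) with hR
  have hx : Complex.exp (x * Complex.I) = R * (Real.cos v + Real.sin v * Complex.I) := by
    rw [Complex.ofReal_cos, Complex.ofReal_sin, ← Complex.exp_mul_I, hR, ← Complex.exp_add, hv]
    congr 1; push_cast; ring
  have hneg : ∀ θ : ℝ, (Real.cos θ - Real.sin θ * Complex.I : ℂ) =
      Complex.exp (((-θ : ℝ) : ℂ) * Complex.I) := by
    intro θ
    rw [Complex.exp_mul_I, ← Complex.ofReal_cos, ← Complex.ofReal_sin, Real.cos_neg, Real.sin_neg]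
    push_cast; ring
  have hy : Complex.exp (y * Complex.I) = R * (Real.cos v - Real.sin v * Complex.I) := by
    rw [hneg, hR, ← Complex.exp_add, hv]
    congr 1; push_cast; ring
  have hz : Complex.exp (z * Complex.I) = R * (Real.cos u - Real.sin u * Complex.I) := by
    rw [hneg, hR, ← Complex.exp_add, hu]
    congr 1; push_cast; ring
  have hRn : ‖R‖ = 1 := Complex.norm_exp_ofReal_mul_I _
  have hsv : Real.sin v ^ 2 = 1 - Real.cos v ^ 2 := Real.sin_sq v
  have hsu : Real.sin u ^ 2 = 1 - Real.cos u ^ 2 := Real.sin_sq u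
  have hc2 : Real.cos v ^ 2 ≤ 1 := Real.cos_sq_le_one v
  have ht2 : Real.cos u ^ 2 ≤ 1 := Real.cos_sq_le_one u
  have hform : kvForm (Complex.exp (x * Complex.I)) (Complex.exp (y * Complex.I))
      (Complex.exp (z * Complex.I)) = R ^ 2 * ((Real.cos u - Real.sin u * Complex.I) *
        (((Real.cos u * (1 - 4 * Real.sin v ^ 2) - 4 * Real.cos v : ℝ) : ℂ) +
          ((-Real.sin u * (1 + 4 * Real.sin v ^ 2) : ℝ) : ℂ) * Complex.I)) := by
    rw [hx, hy, hz, kvForm]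
    have hsu' : (Real.sin u : ℂ) ^ 2 = 1 - (Real.cos u : ℂ) ^ 2 := by exact_mod_cast hsu
    push_cast at *
    linear_combination (4 * R ^ 2 * (Complex.sin v) ^ 2) * hsu' +
      (R ^ 2 * 4 * (Complex.sin v) ^ 2 * (1 - Complex.sin u ^ 2)) * Complex.I_sq
  have hcu : ‖(Real.cos u - Real.sin u * Complex.I : ℂ)‖ = 1 := by
    rw [hneg, Complex.norm_exp_ofReal_mul_I]
  rw [hform, norm_mul, norm_mul, norm_pow, hRn, hcu, one_pow, one_mul, one_mul]
  refine le_of_sq_le_sq ?_ (by norm_num)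
  rw [Complex.sq_norm, Complex.normSq_add_mul_I, mul_pow, neg_sq, hsv, hsu]
  have := trig_quartic_nonneg hc2 ht2
  nlinarith

theorem norm_kvForm_le_of_norm_eq_one {a b c : ℂ} (ha : ‖a‖ = 1) (hb : ‖b‖ = 1) (hc : ‖c‖ = 1) :
    ‖kvForm a b c‖ ≤ 5 := by
  have h := norm_kvForm_exp_le a.arg b.arg c.arg
  have key : ∀ w : ℂ, ‖w‖ = 1 → Complex.exp (w.arg * Complex.I) = w := fun w hw => by
    simpa [hw] using Complex.norm_mul_exp_arg_mul_I w
  rwa [key a ha, key b hb, key c hc] at h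

/-- The maximum principle, applied in one variable at a time, passes from the torus to the polydisc.
-/
theorem norm_kvForm_le {a b c : ℂ} (ha : ‖a‖ ≤ 1) (hb : ‖b‖ ≤ 1) (hc : ‖c‖ ≤ 1) :
    ‖kvForm a b c‖ ≤ 5 := by
  refine norm_le_of_forall_norm_eq_one (f := fun a => kvForm a b c) (by unfold kvForm; fun_prop)
    (fun a ha => ?_) ha
  refine norm_le_of_forall_norm_eq_one (f := fun b => kvForm a b c) (by unfold kvForm; fun_prop)
    (fun b hb => ?_) hb
  exact norm_le_of_forall_norm_eq_one (f := fun c => kvForm a b c) (by unfold kvForm; fun_prop)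
    (fun c hc => norm_kvForm_le_of_norm_eq_one ha hb hc) hc

/-- The coefficients of one fifth of the Varopoulos–Kaijser form. -/
def kvCoeff : Fin 6 → ℂ := ![1 / 5, 1 / 5, 1 / 5, -2 / 5, -2 / 5, -2 / 5]

/-- One fifth of the Varopoulos–Kaijser polynomial. -/
def kvPoly : MvPolynomial (Fin 3) ℂ := ∑ i, MvPolynomial.monomial (quadExp i) (kvCoeff i)

theorem isHomogeneous_kvPoly : kvPoly.IsHomogeneous 2 := by
  refine MvPolynomial.IsHomogeneous.sum _ _ _ fun i _ =>
    MvPolynomial.isHomogeneous_monomial _ ?_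
  rw [Finsupp.degree_eq_sum, Fin.sum_univ_three]
  fin_cases i <;> simp [quadExp]

theorem quadCoeff_kvPoly : quadCoeff kvPoly = kvCoeff := by
  ext i
  simp [quadCoeff, kvPoly, MvPolynomial.coeff_sum, MvPolynomial.coeff_monomial,
    quadExp_injective.eq_iff]

theorem polydiscNorm_kvPoly_le : polydiscNorm kvPoly ≤ 1 := by
  have : Nonempty {z : Fin 3 → ℂ // ∀ j, ‖z j‖ < 1} := ⟨⟨0, by simp⟩⟩
  refine ciSup_le fun z => ?_
  have h := norm_kvForm_le (z.2 0).le (z.2 1).le (z.2 2).le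
  have heq : MvPolynomial.eval z.1 kvPoly = (1 / 5) * kvForm (z.1 0) (z.1 1) (z.1 2) := by
    rw [eval_eq_pairing isHomogeneous_kvPoly, quadCoeff_kvPoly]
    simp [pairing, kvCoeff, kvForm]
    ring
  rw [heq, norm_mul]
  norm_num
  linarith

/-! ### The lower bound -/

/-- The vector `(s, t, 0, 0, …)` of `ℓ²_ℝ`. -/
def planeVec (s t : ℝ) : L2R := lp.single 2 0 s + lp.single 2 1 t

theorem inner_planeVec (s t s' t' : ℝ) :
    inner ℝ (planeVec s t) (planeVec s' t') = s * s' + t * t' := by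
  simp only [planeVec, inner_add_left, lp.inner_single_left]
  simp
  ring

theorem six_fifths_mem_valuesTwo : (6 / 5 : ℝ) ∈ valuesTwo 3 := by
  have hs : Real.sqrt 3 * Real.sqrt 3 = 3 := Real.mul_self_sqrt (by norm_num)
  -- The cube roots of unity: every off-diagonal Gram entry is `-1/2`, so the squares and the cross
  -- terms each contribute `3/5`.
  set x : Fin 3 → L2R := ![planeVec 1 0, planeVec (-1 / 2) (Real.sqrt 3 / 2),
    planeVec (-1 / 2) (-Real.sqrt 3 / 2)] with hx
  have h00 : inner ℝ (x 0) (x 0) = (1 : ℝ) := by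
    simp only [hx, Matrix.cons_val, inner_planeVec]; norm_num
  have h11 : inner ℝ (x 1) (x 1) = (1 : ℝ) := by
    simp only [hx, Matrix.cons_val, inner_planeVec]; linarith
  have h22 : inner ℝ (x 2) (x 2) = (1 : ℝ) := by
    simp only [hx, Matrix.cons_val, inner_planeVec]; linarith
  have h01 : inner ℝ (x 0) (x 1) = (-1 / 2 : ℝ) := by simp [hx, inner_planeVec]
  have h02 : inner ℝ (x 0) (x 2) = (-1 / 2 : ℝ) := by simp [hx, inner_planeVec]
  have h12 : inner ℝ (x 1) (x 2) = (-1 / 2 : ℝ) := by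
    simp only [hx, Matrix.cons_val, inner_planeVec]; linarith
  have hn : ∀ j, inner ℝ (x j) (x j) = (1 : ℝ) := by
    intro j
    fin_cases j
    exacts [h00, h11, h22]
  refine ⟨_, ⟨x, fun j => ?_, rfl⟩, kvPoly, isHomogeneous_kvPoly, polydiscNorm_kvPoly_le, ?_⟩
  · have := hn j
    rw [real_inner_self_eq_norm_sq] at this
    nlinarith [norm_nonneg (x j)]
  · rw [norm_polyEval_opSelf isHomogeneous_kvPoly, quadCoeff_kvPoly]
    simp only [pairing, h00, h11, h22, h01, h02, h12, kvCoeff, Matrix.cons_val]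
    norm_num

end Varopoulos

end

/-- Boundedness is a separate claim because the real `sSup` of an unbounded set is `0`. -/
theorem mainTheorem4 :
    BddAbove (Varopoulos.valuesTwo 3) ∧
      (1.2 : ℝ) ≤ Varopoulos.CTwo 3 ∧ Varopoulos.CTwo 3 ≤ 3 * Real.sqrt 3 / 4 := by
  have hb : BddAbove (Varopoulos.valuesTwo 3) := ⟨_, fun _ h => Varopoulos.le_of_mem_valuesTwo h⟩
  refine ⟨hb, ?_, csSup_le ⟨_, Varopoulos.six_fifths_mem_valuesTwo⟩
    fun _ h => Varopoulos.le_of_mem_valuesTwo h⟩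
  have := le_csSup hb Varopoulos.six_fifths_mem_valuesTwo
  norm_num at this ⊢
  exact this
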